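/- Let $\mathscr{C}$ be a Krull--Schmidt extriangulated category $(\mathscr{C},\mathbb{E},\mathfrak{s})$ in the sense of Nakaoka--Palu, with enough projectives and enough injectives, satisfying the weak idempotent completeness condition: if $gf$ is an inflation then so is $f$, and if $gf$ is a deflation then so is $g$. "Subcategory" means full additive subcategory closed under isomorphisms and direct summands. Higher extension groups are $\mathbb{E}^{i+1}(X,Y)=\mathbb{E}(\Omega^iX,Y)$ for $i\ge 0$, where $\Omega X$ is a syzygy of $X$, i.e. there is an $\mathbb{E}$-triangle $\Omega X\to P\to X\dashrightarrow$ with $P$ projective. For a subcategory $\omega$ put $\omega^{\perp}=\{Y\mid \mathbb{E}^i(X,Y)=0\ \text{for all } i\ge 1,\ X\in\omega\}$; $\omega$ is self-orthogonal if $\omega\subseteq\omega^\perp$. Let $\hat\omega_0=\check\omega_0=\omega$. For $n\geq 0$ let $\hat\omega_{n+1}$ be the class of objects $A$ having an $\mathbb{E}$-triangle $K\to W\to A\dashrightarrow$ with $W\in\omega$ and $K\in\hat\omega_n$, and let $\check\omega_{n+1}$ be the class of objects $A$ having an $\mathbb{E}$-triangle $A\to W\to K\dashrightarrow$ with $W\in\omega$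 and $K\in\check\omega_n$; put $\hat\omega=\bigcup_n\hat\omega_n$ and $\check\omega=\bigcup_n\check\omega_n$. Let ${}_\omega\mathcal{X}$ be the class of objects $A$ for which there are $\mathbb{E}$-triangles $K_{i+1}\to W_i\to K_i\dashrightarrow$ for all $i\ge 0$, with $K_0=A$, all $W_i\in\omega$ and all $K_i\in\omega^\perp$. The subcategory $\omega$ is strongly contravariantly finite if every object $X$ has an $\mathbb{E}$-triangle $K\to W\xrightarrow{g}X\dashrightarrow$ in which $g$ is a right $\omega$-approximation, i.e. $W\in\omega$ and every morphism $W'\to X$ with $W'\in\omega$ factors through $g$. (1) Let $\mathcal{C}$ be a self-orthogonal subcategory, and let $\omega\subseteq{}_{\mathcal{C}}\mathcal{X}$ be a strongly contravariantly finite self-orthogonal subcategory with $\mathcal{C}\subseteq\check\omega$. Then $\omega^\perp\subseteq\mathcal{C}^\perp$ and $\omega^\perp\cap{}_{\mathcal{C}}\mathcal{X}={}_\omega\mathcal{X}$. (2) In particular, if $\mathcal{T}$ is a strongly contravariantly finite $\mathcal{C}$-tilting subcategory, i.e. a strongly contravariantly finite subcategory such that $\mathcal{C}$ and $\mathcal{T}$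 are self-orthogonal, $\mathcal{T}\subseteq\hat{\mathcal{C}}$ and $\mathcal{C}\subseteq\check{\mathcal{T}}$, then $\mathcal{T}^\perp\subseteq\mathcal{C}^\perp$ and $\mathcal{T}^\perp\cap{}_{\mathcal{C}}\mathcal{X}={}_{\mathcal{T}}\mathcal{X}$. -/

import Mathlib

open CategoryTheory CategoryTheory.Limits Opposite

universe w v u

namespace Extri

attribute [local instance] hasBinaryBiproducts_of_finite_biproducts

section Extensions

variable {𝒞 : Type u} [Category.{v} 𝒞] [Preadditive 𝒞] [HasFiniteBiproducts 𝒞]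

/-- The group `𝔼(X, A)` of `𝔼`-extensions. -/
abbrev Ext1 (E : 𝒞ᵒᵖ ⥤ 𝒞 ⥤ AddCommGrpCat.{w}) (X A : 𝒞) : Type w :=
  ((E.obj (op X)).obj A : AddCommGrpCat.{w})

/-- The extension `a_* δ`. -/
def push (E : 𝒞ᵒᵖ ⥤ 𝒞 ⥤ AddCommGrpCat.{w}) {X A A' : 𝒞} (a : A ⟶ A') (δ : Ext1 E X A) :
    Ext1 E X A' :=
  ((E.obj (op X)).map a).hom δ

/-- The extension `c^* δ`. -/
def pull (E : 𝒞ᵒᵖ ⥤ 𝒞 ⥤ AddCommGrpCat.{w}) {X X' A : 𝒞} (c : X' ⟶ X) (δ : Ext1 E X A) :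
    Ext1 E X' A :=
  ((E.map c.op).app A).hom δ

/-- The extension `δ ⊕ δ'` in `𝔼(X ⊞ X', A ⊞ A')`: the element whose components in
`𝔼(X, A)`, `𝔼(X, A')`, `𝔼(X', A)`, `𝔼(X', A')` are `δ`, `0`, `0`, `δ'`. -/
noncomputable def dirSum (E : 𝒞ᵒᵖ ⥤ 𝒞 ⥤ AddCommGrpCat.{w}) {X A X' A' : 𝒞}
    (δ : Ext1 E X A) (δ' : Ext1 E X' A') : Ext1 E (X ⊞ X') (A ⊞ A') :=
  push E biprod.inl (pull E biprod.fst δ) + push E biprod.inr (pull E biprod.snd δ')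

/-- A sequence `A ⟶ B ⟶ X` of two morphisms with fixed end terms. -/
structure Seq (A X : 𝒞) where
  mid : 𝒞
  i : A ⟶ mid
  p : mid ⟶ X

/-- Two sequences with the same end terms are equivalent if an isomorphism of the middle terms
is compatible with both morphisms. -/
def Seq.Equivalent {A X : 𝒞} (S T : Seq A X) : Prop :=
  ∃ b : S.mid ≅ T.mid, S.i ≫ b.hom = T.i ∧ b.hom ≫ T.p = S.p

instance seqSetoid (A X : 𝒞) : Setoid (Seq A X) where
  r := Seq.Equivalent
  iseqv :=
    { refl := fun S => ⟨Iso.refl _, by simp, by simp⟩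
      symm := by
        rintro S T ⟨b, h₁, h₂⟩
        exact ⟨b.symm, by simp [← h₁], by simp [← h₂]⟩
      trans := by
        rintro S T U ⟨b, h₁, h₂⟩ ⟨c, h₃, h₄⟩
        refine ⟨b.trans c, ?_, ?_⟩
        · simp [← h₃, ← h₁]
        · simp [h₄, h₂] }

/-- The equivalence class `[A ⟶ B ⟶ X]`. -/
def seqClass {A B X : 𝒞} (x : A ⟶ B) (y : B ⟶ X) : Quotient (seqSetoid A X) :=
  Quotient.mk _ ⟨B, x, y⟩

variable (𝒞) in
/-- An extriangulated structure `(𝔼, 𝔰)` on the additive category `𝒞`. -/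
structure ExtStructure where
  /-- The bifunctor `𝔼` of extensions. -/
  E : 𝒞ᵒᵖ ⥤ 𝒞 ⥤ AddCommGrpCat.{w}
  additive_left : E.Additive
  additive_right : ∀ X : 𝒞ᵒᵖ, (E.obj X).Additive
  /-- The correspondence `𝔰`. -/
  s : ∀ {X A : 𝒞}, Ext1 E X A → Quotient (seqSetoid A X)
  /-- `𝔰` is a realization. -/
  realization : ∀ {A B X A' B' X' : 𝒞} (δ : Ext1 E X A) (δ' : Ext1 E X' A')
    (x : A ⟶ B) (y : B ⟶ X) (x' : A' ⟶ B') (y' : B' ⟶ X'),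
    s δ = seqClass x y → s δ' = seqClass x' y' →
    ∀ (a : A ⟶ A') (c : X ⟶ X'), push E a δ = pull E c δ' →
      ∃ b : B ⟶ B', x ≫ b = a ≫ x' ∧ y ≫ c = b ≫ y'
  /-- The realization is additive. -/
  s_zero : ∀ A X : 𝒞,
    s (0 : Ext1 E X A) = seqClass (biprod.inl : A ⟶ A ⊞ X) (biprod.snd : A ⊞ X ⟶ X)
  s_dirSum : ∀ {A B X A' B' X' : 𝒞} (δ : Ext1 E X A) (δ' : Ext1 E X' A')
    (x : A ⟶ B) (y : B ⟶ X) (x' : A' ⟶ B') (y' : B' ⟶ X'),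
    s δ = seqClass x y → s δ' = seqClass x' y' →
      s (dirSum E δ δ') = seqClass (biprod.map x x') (biprod.map y y')
  et3 : ∀ {A B X A' B' X' : 𝒞} (δ : Ext1 E X A) (δ' : Ext1 E X' A')
    (x : A ⟶ B) (y : B ⟶ X) (x' : A' ⟶ B') (y' : B' ⟶ X'),
    s δ = seqClass x y → s δ' = seqClass x' y' →
    ∀ (a : A ⟶ A') (b : B ⟶ B'), x ≫ b = a ≫ x' →
      ∃ c : X ⟶ X', push E a δ = pull E c δ' ∧ y ≫ c = b ≫ y'
  et3_op : ∀ {A B X A' B' X' : 𝒞} (δ : Ext1 E X A) (δ' : Ext1 E X' A')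
    (x : A ⟶ B) (y : B ⟶ X) (x' : A' ⟶ B') (y' : B' ⟶ X'),
    s δ = seqClass x y → s δ' = seqClass x' y' →
    ∀ (b : B ⟶ B') (c : X ⟶ X'), y ≫ c = b ≫ y' →
      ∃ a : A ⟶ A', push E a δ = pull E c δ' ∧ x ≫ b = a ≫ x'
  et4 : ∀ {A B C D F : 𝒞} (δ : Ext1 E D A) (δ' : Ext1 E F B)
    (f : A ⟶ B) (f' : B ⟶ D) (g : B ⟶ C) (g' : C ⟶ F),
    s δ = seqClass f f' → s δ' = seqClass g g' →
      ∃ (G : 𝒞) (h : A ⟶ C) (h' : C ⟶ G) (d : D ⟶ G) (e : G ⟶ F) (δ'' : Ext1 E G A),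
        f ≫ g = h ∧ f' ≫ d = g ≫ h' ∧ h' ≫ e = g' ∧
        s δ'' = seqClass h h' ∧
        s (push E f' δ') = seqClass d e ∧
        pull E d δ'' = δ ∧
        push E f δ'' = pull E e δ'
  et4_op : ∀ {A B C D F : 𝒞} (δ : Ext1 E A D) (δ' : Ext1 E B F)
    (f' : D ⟶ B) (f : B ⟶ A) (g' : F ⟶ C) (g : C ⟶ B),
    s δ = seqClass f' f → s δ' = seqClass g' g →
      ∃ (G : 𝒞) (h : C ⟶ A) (h' : G ⟶ C) (d : G ⟶ D) (e : F ⟶ G) (δ'' : Ext1 E A G),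
        g ≫ f = h ∧ d ≫ f' = h' ≫ g ∧ e ≫ h' = g' ∧
        s δ'' = seqClass h' h ∧
        s (pull E f' δ') = seqClass e d ∧
        push E d δ'' = δ ∧
        pull E f δ'' = push E e δ'

end Extensions

section Notions

variable {𝒞 : Type u} [Category.{v} 𝒞] [Preadditive 𝒞] [HasFiniteBiproducts 𝒞]

namespace ExtStructure

variable (S : ExtStructure.{w} 𝒞)

/-- `A ⟶ B ⟶ X` is a conflation if it realizes some extension, that is, if it is part of an
`𝔼`-triangle `A ⟶ B ⟶ X ⇢ δ`. -/
def IsConflation {A B X : 𝒞} (x : A ⟶ B) (y : B ⟶ X) : Prop :=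
  ∃ δ : Ext1 S.E X A, S.s δ = seqClass x y

def IsInflation {A B : 𝒞} (x : A ⟶ B) : Prop :=
  ∃ (X : 𝒞) (y : B ⟶ X), S.IsConflation x y

def IsDeflation {B X : 𝒞} (y : B ⟶ X) : Prop :=
  ∃ (A : 𝒞) (x : A ⟶ B), S.IsConflation x y

def IsProjective (P : 𝒞) : Prop :=
  ∀ {A B X : 𝒞} (x : A ⟶ B) (y : B ⟶ X), S.IsConflation x y →
    ∀ c : P ⟶ X, ∃ b : P ⟶ B, b ≫ y = c

def IsInjective (I : 𝒞) : Prop :=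
  ∀ {A B X : 𝒞} (x : A ⟶ B) (y : B ⟶ X), S.IsConflation x y →
    ∀ a : A ⟶ I, ∃ b : B ⟶ I, x ≫ b = a

class HasEnoughProjectives : Prop where
  exists_conflation : ∀ X : 𝒞, ∃ (K P : 𝒞) (x : K ⟶ P) (y : P ⟶ X),
    S.IsProjective P ∧ S.IsConflation x y

class HasEnoughInjectives : Prop where
  exists_conflation : ∀ A : 𝒞, ∃ (I Z : 𝒞) (x : A ⟶ I) (y : I ⟶ Z),
    S.IsInjective I ∧ S.IsConflation x y

/-- The weak idempotent completeness condition. -/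
def WIC : Prop :=
  (∀ {A B C : 𝒞} (f : A ⟶ B) (g : B ⟶ C), S.IsInflation (f ≫ g) → S.IsInflation f) ∧
  (∀ {A B C : 𝒞} (f : A ⟶ B) (g : B ⟶ C), S.IsDeflation (f ≫ g) → S.IsDeflation g)

section HigherExtensions

variable [S.HasEnoughProjectives]

/-- A syzygy `Ω X`: the first term of a chosen conflation `Ω X ⟶ P ⟶ X` with `P` projective. -/
noncomputable def syzygy (X : 𝒞) : 𝒞 :=
  (HasEnoughProjectives.exists_conflation (S := S) X).choose

/-- The iterated syzygy `Ω^i X`. -/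
noncomputable def iterSyzygy : ℕ → 𝒞 → 𝒞
  | 0, X => X
  | i + 1, X => S.syzygy (iterSyzygy i X)

/-- The higher extension group `𝔼^(i+1)(X, Y) = 𝔼(Ω^i X, Y)`, for `i ≥ 0`. -/
noncomputable abbrev ExtSucc (i : ℕ) (X Y : 𝒞) : Type w :=
  Ext1 S.E (S.iterSyzygy i X) Y

/-- `ω^⊥`: the objects `Y` with `𝔼^i(X, Y) = 0` for all `i ≥ 1` and all `X` in `ω`. -/
def rightPerp (ω : ObjectProperty 𝒞) : ObjectProperty 𝒞 := fun Y =>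
  ∀ (i : ℕ) (X : 𝒞), ω X → ∀ ξ : S.ExtSucc i X Y, ξ = 0

def SelfOrthogonal (ω : ObjectProperty 𝒞) : Prop :=
  ω ≤ S.rightPerp ω

/-- `_ωX`: the objects `A` for which there are `𝔼`-triangles `K_{i+1} ⟶ W_i ⟶ K_i ⇢`, `i ≥ 0`,
with `K_0 = A`, all `W_i` in `ω` and all `K_i` in `ω^⊥`. The differentials of the resulting
sequence `⋯ ⟶ W_1 ⟶ W_0 ⟶ A` are the composites `f (i+1) ≫ g i` and `f 0`. -/
def leftX (ω : ObjectProperty 𝒞) : ObjectProperty 𝒞 := fun A =>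
  ∃ (K W : ℕ → 𝒞) (g : ∀ i, K (i + 1) ⟶ W i) (f : ∀ i, W i ⟶ K i),
    K 0 = A ∧ ∀ i, S.IsConflation (g i) (f i) ∧ ω (W i) ∧ S.rightPerp ω (K i)

end HigherExtensions

/-- `hat ω n`: the objects `A` with an `𝔼`-triangle sequence `W_n ⟶ ⋯ ⟶ W_0 ⟶ A`, all `W_i`
in `ω`; it consists of `𝔼`-triangles `K_{i+1} ⟶ W_i ⟶ K_i ⇢` for `0 ≤ i < n`, with `K_0 = A`
and `K_n = W_n`. -/
def hatN (ω : ObjectProperty 𝒞) : ℕ → ObjectProperty 𝒞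
  | 0 => ω
  | n + 1 => fun A => ∃ (K W : 𝒞) (g : K ⟶ W) (f : W ⟶ A),
      S.IsConflation g f ∧ ω W ∧ hatN ω n K

def hat (ω : ObjectProperty 𝒞) : ObjectProperty 𝒞 := fun A => ∃ n, S.hatN ω n A

/-- `check ω n`: the objects `A` with an `𝔼`-triangle sequence `A ⟶ W^0 ⟶ ⋯ ⟶ W^n`, all `W^i`
in `ω`. -/
def checkN (ω : ObjectProperty 𝒞) : ℕ → ObjectProperty 𝒞
  | 0 => ω
  | n + 1 => fun A => ∃ (W K : 𝒞) (g : A ⟶ W) (f : W ⟶ K),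
      S.IsConflation g f ∧ ω W ∧ checkN ω n K

def check (ω : ObjectProperty 𝒞) : ObjectProperty 𝒞 := fun A => ∃ n, S.checkN ω n A

/-- Every object `X` has an `𝔼`-triangle `K ⟶ W ⟶ X ⇢` whose deflation is a right
`ω`-approximation of `X`. -/
def StronglyContravariantlyFinite (ω : ObjectProperty 𝒞) : Prop :=
  ∀ X : 𝒞, ∃ (K W : 𝒞) (k : K ⟶ W) (g : W ⟶ X), S.IsConflation k g ∧ ω W ∧
    ∀ (W' : 𝒞), ω W' → ∀ h : W' ⟶ X, ∃ l : W' ⟶ W, l ≫ g = h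

/-- `(C, T)` is a tilting pair, that is, `T` is `C`-tilting. -/
structure IsTiltingPair [S.HasEnoughProjectives] (C T : ObjectProperty 𝒞) : Prop where
  selfOrthogonal_left : S.SelfOrthogonal C
  selfOrthogonal_right : S.SelfOrthogonal T
  le_hat : T ≤ S.hat C
  le_check : C ≤ S.check T

end ExtStructure

variable (𝒞) in
/-- Every object is a finite direct sum of objects with local endomorphism rings. -/
def IsKrullSchmidt : Prop :=
  ∀ X : 𝒞, ∃ (n : ℕ) (Y : Fin n → 𝒞), (∀ i, IsLocalRing (End (Y i))) ∧ Nonempty (X ≅ ⨁ Y)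

/-- The (full) subcategories considered: additive, and closed under isomorphisms and direct
summands. -/
structure IsAddSubcategory (P : ObjectProperty 𝒞) : Prop where
  closedUnderIso : P.IsClosedUnderIsomorphisms
  containsZero : P.ContainsZero
  biprod : ∀ X Y : 𝒞, P X → P Y → P (X ⊞ Y)
  summand : ∀ X Y : 𝒞, P (X ⊞ Y) → P X

end Notions

end Extri

/-! For `Y` in `ω^⊥`, dimension shifting along the finite `ω`-coresolution of an object of `C` kills
all `𝔼^i(-, Y)` on it; hence `ω^⊥ ⊆ C^⊥` (`rightPerp_le_of_le_check`). The equality of classes is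
coinductive. `leftX` is the largest subclass of the right perpendicular class whose objects are
covered from the subcategory with kernels again in the subclass (`le_leftX`), so each inclusion
needs only one covering step. For `ω^⊥ ∩ leftX C ⊆ leftX ω`, cover `A` by a right `ω`-approximation:
its kernel lies in `ω^⊥` (Wakamatsu's argument), and in `leftX C` by closure under kernels that lie
in `C^⊥` (`Conf.leftX_left`). For the converse, `leftX ω` is enlarged to the extensions of its
objects by objects of `leftX C`; this class is covered by `C` (`leftX_le_leftX`). Both steps rest on
closure of `leftX C` under extensions and on weak pullbacks of deflations. The tilting case follows
from `hat C ⊆ leftX C`. -/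

namespace Extri

attribute [local instance] hasBinaryBiproducts_of_finite_biproducts

/-! ### Functoriality of extensions -/

section Functoriality

variable {𝒞 : Type u} [Category.{v} 𝒞] (E : 𝒞ᵒᵖ ⥤ 𝒞 ⥤ AddCommGrpCat.{w})

lemma push_zero {X A A' : 𝒞} (a : A ⟶ A') : push E a (0 : Ext1 E X A) = 0 :=
  map_zero _

lemma pull_zero {X X' A : 𝒞} (c : X' ⟶ X) : pull E c (0 : Ext1 E X A) = 0 :=
  map_zero _

lemma push_add {X A A' : 𝒞} (a : A ⟶ A') (δ ε : Ext1 E X A) :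
    push E a (δ + ε) = push E a δ + push E a ε :=
  map_add _ _ _

lemma push_id {X A : 𝒞} (δ : Ext1 E X A) : push E (𝟙 A) δ = δ := by
  simp [push]

lemma pull_id {X A : 𝒞} (δ : Ext1 E X A) : pull E (𝟙 X) δ = δ := by
  simp [pull]

lemma push_comp {X A A' A'' : 𝒞} (a : A ⟶ A') (b : A' ⟶ A'') (δ : Ext1 E X A) :
    push E (a ≫ b) δ = push E b (push E a δ) := by
  simp [push]

lemma pull_comp {X X' X'' A : 𝒞} (c : X' ⟶ X) (d : X'' ⟶ X') (δ : Ext1 E X A) :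
    pull E (d ≫ c) δ = pull E d (pull E c δ) := by
  simp [pull]

lemma push_pull {X X' A A' : 𝒞} (a : A ⟶ A') (c : X' ⟶ X) (δ : Ext1 E X A) :
    push E a (pull E c δ) = pull E c (push E a δ) :=
  (ConcreteCategory.congr_hom ((E.map c.op).naturality a) δ).symm

end Functoriality

section Realization

variable {𝒞 : Type u} [Category.{v} 𝒞]

lemma seqClass_eq_of_iso {A X B B' : 𝒞} (x : A ⟶ B) (y : B ⟶ X) (b : B ≅ B') :
    seqClass x y = seqClass (x ≫ b.hom) (b.inv ≫ y) :=
  Quotient.sound ⟨b, rfl, by simp⟩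

lemma exists_iso_of_seqClass_eq {A X B B' : 𝒞} {x : A ⟶ B} {y : B ⟶ X} {x' : A ⟶ B'}
    {y' : B' ⟶ X} (h : seqClass x y = seqClass x' y') :
    ∃ b : B ≅ B', x ≫ b.hom = x' ∧ b.hom ≫ y' = y :=
  Quotient.exact h

end Realization

namespace ExtStructure

variable {𝒞 : Type u} [Category.{v} 𝒞] [Preadditive 𝒞] [HasFiniteBiproducts 𝒞]

variable (S : ExtStructure.{w} 𝒞)

lemma zero_push {X A A' : 𝒞} (δ : Ext1 S.E X A) : push S.E (0 : A ⟶ A') δ = 0 := by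
  have := S.additive_right (op X)
  simp [push]

lemma exists_realization {X A : 𝒞} (δ : Ext1 S.E X A) :
    ∃ (B : 𝒞) (x : A ⟶ B) (y : B ⟶ X), S.s δ = seqClass x y := by
  obtain ⟨⟨B, x, y⟩, h⟩ := Quotient.exists_rep (S.s δ)
  exact ⟨B, x, y, h.symm⟩

/-! ### Exact sequences attached to a conflation -/

section Exactness

variable {S} {A B X : 𝒞} {δ : Ext1 S.E X A} {x : A ⟶ B} {y : B ⟶ X} (h : S.s δ = seqClass x y)

include h

lemma comp_eq_zero : x ≫ y = 0 := by
  obtain ⟨O, hO⟩ := HasZeroObject.zero (C := 𝒞)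
  obtain ⟨c, -, hc⟩ := S.et3 (0 : Ext1 S.E O A) δ _ _ x y (S.s_zero A O) h (𝟙 A)
    (biprod.fst ≫ x) (by simp)
  have := congrArg (fun t => biprod.inl ≫ t) hc
  simpa using this.symm

lemma exists_lift_of_comp_eq_zero {Z : 𝒞} (f : Z ⟶ B) (hf : f ≫ y = 0) :
    ∃ a : Z ⟶ A, a ≫ x = f := by
  obtain ⟨O, hO⟩ := HasZeroObject.zero (C := 𝒞)
  obtain ⟨a, -, ha⟩ := S.et3_op (0 : Ext1 S.E O Z) δ _ _ x y (S.s_zero Z O) h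
    (biprod.fst ≫ f) 0 (by simp [hf])
  exact ⟨a, by simpa using ha.symm⟩

/-- An endomorphism of a conflation which is the identity at both ends is invertible. -/
lemma isIso_of_comp_eq {b : B ⟶ B} (hx : x ≫ b = x) (hy : b ≫ y = y) : IsIso b := by
  obtain ⟨a, ha⟩ := exists_lift_of_comp_eq_zero h (b - 𝟙 B) (by simp [hy])
  have hb : (b - 𝟙 B) ≫ (b - 𝟙 B) = 0 := by
    nth_rewrite 1 [← ha]
    rw [Category.assoc, Preadditive.comp_sub, hx, Category.comp_id, sub_self, comp_zero]
  have hb' : b ≫ b = b + b - 𝟙 B := by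
    simp only [Preadditive.comp_sub, Preadditive.sub_comp, Category.comp_id,
      Category.id_comp] at hb
    rw [← sub_eq_zero, ← hb]
    abel
  exact ⟨𝟙 B + 𝟙 B - b, by simp [hb'], by simp [hb']⟩

lemma pull_deflation : pull S.E y δ = 0 := by
  obtain ⟨a, ha, -⟩ := S.et3_op (0 : Ext1 S.E B A) δ _ _ x y (S.s_zero A B) h
    (biprod.desc x (𝟙 B)) y (by ext <;> simp [comp_eq_zero h])
  rw [← ha, push_zero]

lemma push_inflation : push S.E x δ = 0 := by
  obtain ⟨c, hc, -⟩ := S.et3 δ (0 : Ext1 S.E X B) x y _ _ h (S.s_zero B X) x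
    (biprod.lift (𝟙 B) y) (by ext <;> simp [comp_eq_zero h])
  rw [hc, pull_zero]

lemma exists_lift {Z : 𝒞} (c : Z ⟶ X) (hc : pull S.E c δ = 0) : ∃ l : Z ⟶ B, l ≫ y = c := by
  obtain ⟨b, -, hb⟩ := S.realization (0 : Ext1 S.E Z A) δ _ _ x y (S.s_zero A Z) h (𝟙 A) c
    (by rw [hc, push_zero])
  exact ⟨biprod.inr ≫ b, by simp [← hb]⟩

lemma exists_desc {Z : 𝒞} (a : A ⟶ Z) (ha : push S.E a δ = 0) : ∃ l : B ⟶ Z, x ≫ l = a := by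
  obtain ⟨b, hb, -⟩ := S.realization δ (0 : Ext1 S.E X Z) x y _ _ h (S.s_zero Z X) a (𝟙 X)
    (by rw [ha, pull_zero])
  exact ⟨b ≫ biprod.fst, by rw [← Category.assoc, hb]; simp⟩

lemma exists_pull_eq {Z : 𝒞} (ε : Ext1 S.E Z A) (hε : push S.E x ε = 0) :
    ∃ c : Z ⟶ X, pull S.E c δ = ε := by
  obtain ⟨Y, i, p, hY⟩ := S.exists_realization ε
  obtain ⟨b, hb⟩ := exists_desc hY x hε
  obtain ⟨c, hc, -⟩ := S.et3 ε δ i p x y hY h (𝟙 A) b (by simp [hb])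
  exact ⟨c, by rw [← hc, push_id]⟩

lemma exists_push_eq {Z : 𝒞} (ε : Ext1 S.E X Z) (hε : pull S.E y ε = 0) :
    ∃ a : A ⟶ Z, push S.E a δ = ε := by
  obtain ⟨Y, i, p, hY⟩ := S.exists_realization ε
  obtain ⟨b, hb⟩ := exists_lift hY y hε
  obtain ⟨a, ha, -⟩ := S.et3_op δ ε x y i p h hY b (𝟙 X) (by simp [hb])
  exact ⟨a, by rw [ha, pull_id]⟩

/-- Exactness at `𝔼(Z, B)`, which needs the octahedral axiom: a section of `e`, available since `y_*
ε = 0`, pulls `δ''` back to a preimage. -/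
lemma exists_push_inflation_eq {Z : 𝒞} (ε : Ext1 S.E Z B) (hε : push S.E y ε = 0) :
    ∃ ε' : Ext1 S.E Z A, push S.E x ε' = ε := by
  obtain ⟨D, i, p, hD⟩ := S.exists_realization ε
  obtain ⟨G, k, k', d, e, δ'', -, -, -, -, hde, -, he⟩ := S.et4 δ ε x y i p h hD
  obtain ⟨r, hr⟩ := exists_lift hde (𝟙 Z) (by rw [hε, pull_zero])
  exact ⟨pull S.E r δ'', by rw [push_pull, he, ← pull_comp, hr, pull_id]⟩

end Exactness

/-- The group `𝔼(X, A)` vanishes. -/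
def ExtVanishes (X A : 𝒞) : Prop :=
  ∀ ξ : Ext1 S.E X A, ξ = 0

/-- There is a conflation `A ⟶ B ⟶ X`. -/
def Conf (A B X : 𝒞) : Prop :=
  ∃ (δ : Ext1 S.E X A) (x : A ⟶ B) (y : B ⟶ X), S.s δ = seqClass x y

variable {S}

lemma IsConflation.conf {A B X : 𝒞} {x : A ⟶ B} {y : B ⟶ X} (h : S.IsConflation x y) :
    S.Conf A B X :=
  ⟨h.choose, x, y, h.choose_spec⟩

lemma IsProjective.extVanishes {P : 𝒞} (hP : S.IsProjective P) (A : 𝒞) :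
    S.ExtVanishes P A := by
  intro ξ
  obtain ⟨B, x, y, h⟩ := S.exists_realization ξ
  obtain ⟨b, hb⟩ := hP x y ⟨ξ, h⟩ (𝟙 P)
  rw [← pull_id S.E ξ, ← hb, pull_comp, pull_deflation h, pull_zero]

lemma IsInjective.extVanishes {I : 𝒞} (hI : S.IsInjective I) (X : 𝒞) :
    S.ExtVanishes X I := by
  intro ξ
  obtain ⟨B, x, y, h⟩ := S.exists_realization ξ
  obtain ⟨b, hb⟩ := hI x y ⟨ξ, h⟩ (𝟙 I)
  rw [← push_id S.E ξ, ← hb, push_comp, push_inflation h, push_zero]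

/-! ### Vanishing along conflations, and operations on conflations -/

namespace Conf

variable {A B X : 𝒞}

lemma extVanishes_mid (h : S.Conf A B X) {Z : 𝒞} (hA : S.ExtVanishes Z A)
    (hX : S.ExtVanishes Z X) : S.ExtVanishes Z B := by
  obtain ⟨δ, x, y, h⟩ := h
  intro ε
  obtain ⟨ε', rfl⟩ := exists_push_inflation_eq h ε (hX _)
  rw [hA ε', push_zero]

/-- Here `K` is a syzygy of `Z`, so this is the segment `𝔼(Z, X) → 𝔼²(Z, A) → 𝔼²(Z, B)` of the long
exact sequence. -/
lemma extVanishes_left (h : S.Conf A B X) {K P Z : 𝒞} (hP : S.IsProjective P)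
    (hZ : S.Conf K P Z) (hX : S.ExtVanishes Z X) (hB : S.ExtVanishes K B) :
    S.ExtVanishes K A := by
  obtain ⟨δ, x, y, h⟩ := h
  obtain ⟨σ, i, p, hσ⟩ := hZ
  intro ε
  obtain ⟨c, rfl⟩ := exists_pull_eq h ε (hB _)
  obtain ⟨l, rfl⟩ := exists_desc hσ c (hX _)
  rw [pull_comp, hP.extVanishes A (pull S.E l δ), pull_zero]

lemma extVanishes_right (h : S.Conf A B X) {K P Z : 𝒞} (hP : S.IsProjective P)
    (hZ : S.Conf K P Z) (hB : S.ExtVanishes Z B) (hA : S.ExtVanishes K A) :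
    S.ExtVanishes Z X := by
  obtain ⟨δ, x, y, h⟩ := h
  obtain ⟨σ, i, p, hσ⟩ := hZ
  intro ε
  obtain ⟨a, rfl⟩ := exists_push_eq hσ ε (hP.extVanishes X _)
  obtain ⟨l, rfl⟩ := exists_lift h a (hA _)
  rw [push_comp, hB (push S.E l σ), push_zero]

lemma extVanishes_first (h : S.Conf A B X) {Z I Z' : 𝒞} (hI : S.IsInjective I)
    (hZ : S.Conf Z I Z') (hB : S.ExtVanishes B Z) (hX : S.ExtVanishes X Z') :
    S.ExtVanishes A Z := by
  obtain ⟨δ, x, y, h⟩ := h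
  obtain ⟨σ, i, p, hσ⟩ := hZ
  intro ε
  obtain ⟨c, rfl⟩ := exists_pull_eq hσ ε (hI.extVanishes A _)
  obtain ⟨l, rfl⟩ := exists_desc h c (hX _)
  rw [pull_comp, hB (pull S.E l σ), pull_zero]

lemma of_iso (h : S.Conf A B X) {B' : 𝒞} (b : B ≅ B') : S.Conf A B' X := by
  obtain ⟨δ, x, y, h⟩ := h
  exact ⟨δ, _, _, h.trans (seqClass_eq_of_iso x y b)⟩

variable (S) in
lemma biprod (A X : 𝒞) : S.Conf A (A ⊞ X) X :=
  ⟨0, _, _, S.s_zero A X⟩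

variable (S) in
lemma of_isZero {O : 𝒞} (hO : IsZero O) (X : 𝒞) : S.Conf O X X :=
  (Conf.biprod S O X).of_iso
    { hom := biprod.snd
      inv := biprod.inr
      hom_inv_id := by ext <;> first | exact hO.eq_of_src _ _ | simp }

lemma nonempty_iso_biprod (h : S.Conf A B X) (hs : S.ExtVanishes X A) :
    Nonempty (B ≅ A ⊞ X) := by
  obtain ⟨δ, x, y, h⟩ := h
  rw [hs δ, S.s_zero] at h
  obtain ⟨b, -⟩ := exists_iso_of_seqClass_eq h
  exact ⟨b.symm⟩

lemma swap (h : S.Conf A B X) (hs : S.ExtVanishes X A) : S.Conf X B A := by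
  obtain ⟨b⟩ := h.nonempty_iso_biprod hs
  exact (Conf.biprod S X A).of_iso ((biprod.braiding X A).trans b.symm)

/-- Deflations compose. -/
lemma comp {K D : 𝒞} (h : S.Conf A B X) (h' : S.Conf K D B) :
    ∃ G, S.Conf G D X ∧ S.Conf K G A := by
  obtain ⟨δ, x, y, h⟩ := h
  obtain ⟨δ', x', y', h'⟩ := h'
  obtain ⟨G, k, k', d, e, δ'', -, -, -, h₁, h₂, -⟩ := S.et4_op δ δ' x y x' y' h h'
  exact ⟨G, ⟨_, _, _, h₁⟩, ⟨_, _, _, h₂⟩⟩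

lemma of_iso_right (h : S.Conf A B X) {X' : 𝒞} (c : X ≅ X') : S.Conf A B X' := by
  obtain ⟨δ, x, y, h⟩ := h
  obtain ⟨D, i, p, hD⟩ := S.exists_realization (pull S.E c.inv δ)
  obtain ⟨f, hf, hf'⟩ := S.realization δ _ x y i p h hD (𝟙 A) c.hom
    (by rw [← pull_comp, c.hom_inv_id, push_id, pull_id])
  obtain ⟨g, hg, hg'⟩ := S.realization _ δ i p x y hD h (𝟙 A) c.inv (by rw [push_id])
  -- Both composites fix the end terms, hence are invertible, which forces `g` itself to be
  -- invertible.
  have h₁ : IsIso (f ≫ g) := isIso_of_comp_eq h (by rw [reassoc_of% hf, hg]; simp)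
    (by rw [Category.assoc, ← hg', ← reassoc_of% hf']; simp)
  have h₂ : IsIso (g ≫ f) := isIso_of_comp_eq hD (by rw [reassoc_of% hg, hf]; simp)
    (by rw [Category.assoc, ← hf', ← reassoc_of% hg']; simp)
  have : IsIso g := by
    have : Mono g := mono_of_mono g f
    have : IsSplitEpi g := ⟨⟨inv (f ≫ g) ≫ f, by simp⟩⟩
    exact isIso_of_mono_of_isSplitEpi g
  exact Conf.of_iso ⟨_, i, p, hD⟩ (asIso g)

/-- The octahedral axiom for `ι` followed by `j` realizes `π_* μ` with the cone of `ι ≫ j` as middle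
term; uniqueness of realizations identifies that cone with `B₁`. -/
lemma of_push {A₁ A₂ A' M B₁ : 𝒞} {μ : Ext1 S.E X A'} {j : A' ⟶ M} {e : M ⟶ X}
    (hμ : S.s μ = seqClass j e) {ν : Ext1 S.E A₁ A₂} {ι : A₂ ⟶ A'} {π : A' ⟶ A₁}
    (hν : S.s ν = seqClass ι π) {x : A₁ ⟶ B₁} {y : B₁ ⟶ X}
    (h : S.s (push S.E π μ) = seqClass x y) : S.Conf A₂ M B₁ := by
  obtain ⟨G, k, k', d, e', δ'', -, -, -, h₁, h₂, -⟩ := S.et4 ν μ ι π j e hν hμ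
  obtain ⟨b, -⟩ := exists_iso_of_seqClass_eq (h₂.symm.trans h)
  exact Conf.of_iso_right ⟨_, _, _, h₁⟩ b

/-- Two deflations onto the same object have a common weak pullback. -/
lemma pullback {K D : 𝒞} (h : S.Conf A B X) (h' : S.Conf K D X) :
    ∃ M, S.Conf A M D ∧ S.Conf K M B := by
  obtain ⟨δ, x, y, h⟩ := h
  obtain ⟨δ', x', y', h'⟩ := h'
  -- `M` realizes the extension with components `δ` and `δ'`; dividing out either summand of `A ⊞ K`
  -- leaves the other given conflation.
  let μ : Ext1 S.E X (A ⊞ K) := push S.E biprod.inl δ + push S.E biprod.inr δ'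
  obtain ⟨M, j, e, hM⟩ := S.exists_realization μ
  have h₁ : push S.E biprod.fst μ = δ := by
    simp only [μ, push_add, ← push_comp, biprod.inl_fst, biprod.inr_fst, push_id, zero_push,
      add_zero]
  have h₂ : push S.E biprod.snd μ = δ' := by
    simp only [μ, push_add, ← push_comp, biprod.inl_snd, biprod.inr_snd, push_id, zero_push,
      zero_add]
  have hK : S.s (0 : Ext1 S.E A K) =
      seqClass (biprod.inr : K ⟶ A ⊞ K) (biprod.fst : A ⊞ K ⟶ A) := by
    rw [S.s_zero, seqClass_eq_of_iso _ _ (biprod.braiding K A)]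
    congr 1 <;> ext <;> simp
  exact ⟨M, of_push hM (S.s_zero A K) (h₂ ▸ h'), of_push hM hK (h₁ ▸ h)⟩

end Conf

/-! ### Right perpendicular classes and dimension shifting -/

section Perp

variable (S) in
lemma exists_conf_syzygy [S.HasEnoughProjectives] (X : 𝒞) :
    ∃ P : 𝒞, S.IsProjective P ∧ S.Conf (S.syzygy X) P X := by
  obtain ⟨P, x, y, hP, h⟩ :=
    (HasEnoughProjectives.exists_conflation (S := S) X).choose_spec
  exact ⟨P, hP, h.conf⟩

variable (S) in
/-- A cosyzygy of `A`: the last term of a chosen conflation `A ⟶ I ⟶ Z` with `I` injective. -/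
noncomputable def cosyzygy [S.HasEnoughInjectives] (A : 𝒞) : 𝒞 :=
  (HasEnoughInjectives.exists_conflation (S := S) A).choose_spec.choose

variable (S) in
lemma exists_conf_cosyzygy [S.HasEnoughInjectives] (A : 𝒞) :
    ∃ I : 𝒞, S.IsInjective I ∧ S.Conf A I (S.cosyzygy A) := by
  obtain ⟨x, y, hI, h⟩ :=
    (HasEnoughInjectives.exists_conflation (S := S) A).choose_spec.choose_spec
  exact ⟨_, hI, h.conf⟩

variable [S.HasEnoughProjectives]

lemma extVanishes_syzygy_iff [S.HasEnoughInjectives] (X Y : 𝒞) :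
    S.ExtVanishes (S.syzygy X) Y ↔ S.ExtVanishes X (S.cosyzygy Y) := by
  obtain ⟨P, hP, hX⟩ := S.exists_conf_syzygy X
  obtain ⟨I, hI, hY⟩ := S.exists_conf_cosyzygy Y
  exact ⟨fun h => hY.extVanishes_right hP hX (hI.extVanishes _) h,
    fun h => hY.extVanishes_left hP hX h (hI.extVanishes _)⟩

/-- Moves the shift to the second variable, so that conflations in the first variable can be used
without comparing syzygies of their terms. -/
lemma extVanishes_iterSyzygy_iff [S.HasEnoughInjectives] (i : ℕ) (X Y : 𝒞) :
    S.ExtVanishes (S.iterSyzygy i X) Y ↔ S.ExtVanishes X (S.cosyzygy^[i] Y) := by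
  induction i generalizing Y with
  | zero => exact Iff.rfl
  | succ i ih => exact (extVanishes_syzygy_iff _ _).trans (ih _)

variable {ω : ObjectProperty 𝒞} {A B X : 𝒞}

lemma Conf.rightPerp_mid (h : S.Conf A B X) (hA : S.rightPerp ω A) (hX : S.rightPerp ω X) :
    S.rightPerp ω B :=
  fun i Z hZ => h.extVanishes_mid (hA i Z hZ) (hX i Z hZ)

lemma Conf.rightPerp_right (h : S.Conf A B X) (hA : S.rightPerp ω A) (hB : S.rightPerp ω B) :
    S.rightPerp ω X := by
  intro i Z hZ
  obtain ⟨P, hP, h'⟩ := S.exists_conf_syzygy (S.iterSyzygy i Z)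
  exact h.extVanishes_right hP h' (hB i Z hZ) (hA (i + 1) Z hZ)

lemma Conf.rightPerp_left (h : S.Conf A B X) (hB : S.rightPerp ω B) (hX : S.rightPerp ω X)
    (hA : ∀ Z, ω Z → S.ExtVanishes Z A) : S.rightPerp ω A := by
  intro i Z hZ
  cases i with
  | zero => exact hA Z hZ
  | succ i =>
    obtain ⟨P, hP, h'⟩ := S.exists_conf_syzygy (S.iterSyzygy i Z)
    exact h.extVanishes_left hP h' (hX i Z hZ) (hB (i + 1) Z hZ)

/-- Wakamatsu's argument: an extension of `Z` by `K` is a pullback along some `Z ⟶ X`, which lifts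
through the approximation, so it vanishes. Higher degrees follow by shifting. -/
lemma rightPerp_of_right_approximation {K W : 𝒞} {k : K ⟶ W} {g : W ⟶ X}
    (h : S.IsConflation k g) (hg : ∀ W', ω W' → ∀ f : W' ⟶ X, ∃ l : W' ⟶ W, l ≫ g = f)
    (hW : S.rightPerp ω W) (hX : S.rightPerp ω X) : S.rightPerp ω K := by
  refine h.conf.rightPerp_left hW hX fun Z hZ ε => ?_
  obtain ⟨δ, hδ⟩ := h
  obtain ⟨c, rfl⟩ := exists_pull_eq hδ ε (hW 0 Z hZ _)
  obtain ⟨l, rfl⟩ := hg Z hZ c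
  rw [pull_comp, pull_deflation hδ, pull_zero]

lemma extVanishes_iterCosyzygy_of_checkN [S.HasEnoughInjectives] {Y : 𝒞}
    (hY : S.rightPerp ω Y) (n i : ℕ) (hX : S.checkN ω n X) :
    S.ExtVanishes X (S.cosyzygy^[i] Y) := by
  induction n generalizing X i with
  | zero => exact (extVanishes_iterSyzygy_iff i X Y).1 (hY i X hX)
  | succ n ih =>
    obtain ⟨W, K, g, f, h, hW, hK⟩ := hX
    obtain ⟨I, hI, h'⟩ := S.exists_conf_cosyzygy (S.cosyzygy^[i] Y)
    -- Shortening the coresolution by one costs one more cosyzygy, which is why `i` varies in the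
    -- induction.
    refine h.conf.extVanishes_first hI h' ((extVanishes_iterSyzygy_iff i W Y).1 (hY i W hW)) ?_
    rw [← Function.iterate_succ_apply' S.cosyzygy]
    exact ih (i + 1) hK

lemma rightPerp_le_of_le_check [S.HasEnoughInjectives] {C : ObjectProperty 𝒞}
    (h : C ≤ S.check ω) : S.rightPerp ω ≤ S.rightPerp C := by
  intro Y hY i X hX
  obtain ⟨n, hn⟩ := h X hX
  exact (extVanishes_iterSyzygy_iff i X Y).2 (extVanishes_iterCosyzygy_of_checkN hY n i hn)

end Perp

/-! ### Closure properties of `leftX` by coinduction -/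

section LeftX

variable [S.HasEnoughProjectives] {C : ObjectProperty 𝒞} {A B X : 𝒞}

lemma rightPerp_of_leftX (h : S.leftX C A) : S.rightPerp C A := by
  obtain ⟨K, W, g, f, rfl, h⟩ := h
  exact (h 0).2.2

lemma exists_conf_of_leftX (h : S.leftX C A) :
    ∃ K W, S.Conf K W A ∧ C W ∧ S.leftX C K := by
  obtain ⟨K, W, g, f, rfl, h⟩ := h
  exact ⟨K 1, W 0, (h 0).1.conf, (h 0).2.1, fun i => K (i + 1), fun i => W (i + 1),
    fun i => g (i + 1), fun i => f (i + 1), rfl, fun i => h (i + 1)⟩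

/-- `leftX C` is the largest class of objects of `C^⊥` which are covered by objects of `C` with
kernels in the class. -/
lemma le_leftX {Z : ObjectProperty 𝒞} (hZ : Z ≤ S.rightPerp C)
    (h : ∀ A, Z A → ∃ K W, S.Conf K W A ∧ C W ∧ Z K) : Z ≤ S.leftX C := by
  choose! K W hc hW hK using h
  intro A hA
  have hZi : ∀ i, Z (K^[i] A) := fun i => by
    induction i with
    | zero => exact hA
    | succ i ih => rw [Function.iterate_succ_apply']; exact hK _ ih
  have hc' : ∀ i, S.Conf (K^[i + 1] A) (W (K^[i] A)) (K^[i] A) := fun i => by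
    rw [Function.iterate_succ_apply']
    exact hc _ (hZi i)
  choose δ g f hgf using hc'
  exact ⟨fun i => K^[i] A, fun i => W (K^[i] A), g, f, rfl,
    fun i => ⟨⟨δ i, hgf i⟩, hW _ (hZi i), hZ _ (hZi i)⟩⟩

lemma leftX_of_conf {K W : 𝒞} (h : S.Conf K W A) (hA : S.rightPerp C A) (hW : C W)
    (hK : S.leftX C K) : S.leftX C A := by
  refine le_leftX (Z := fun A => S.rightPerp C A ∧ ∃ K W, S.Conf K W A ∧ C W ∧ S.leftX C K)
    (fun _ h => h.1) ?_ A ⟨hA, K, W, h, hW, hK⟩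
  rintro A ⟨-, K, W, h, hW, hK⟩
  exact ⟨K, W, h, hW, rightPerp_of_leftX hK, exists_conf_of_leftX hK⟩

lemma le_leftX_of_selfOrthogonal (hC : IsAddSubcategory C) (hself : S.SelfOrthogonal C) :
    C ≤ S.leftX C := by
  have := hC.containsZero
  obtain ⟨O, hO, hCO⟩ := C.exists_prop_of_containsZero
  exact le_leftX hself fun A hA => ⟨O, A, Conf.of_isZero S hO A, hA, hCO⟩

/-- A horseshoe argument, run on the class of all such extensions. -/
lemma Conf.leftX_mid (hC : IsAddSubcategory C) (hself : S.SelfOrthogonal C)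
    (h : S.Conf A B X) (hA : S.leftX C A) (hX : S.leftX C X) : S.leftX C B := by
  refine le_leftX (Z := fun B => ∃ A X, S.Conf A B X ∧ S.leftX C A ∧ S.leftX C X) ?_ ?_ B
    ⟨A, X, h, hA, hX⟩
  · rintro B ⟨A, X, h, hA, hX⟩
    exact h.rightPerp_mid (rightPerp_of_leftX hA) (rightPerp_of_leftX hX)
  · rintro B ⟨A, X, h, hA, hX⟩
    have := hC.closedUnderIso
    obtain ⟨A', WA, hcA, hWA, hA'⟩ := exists_conf_of_leftX hA
    obtain ⟨X', WX, hcX, hWX, hX'⟩ := exists_conf_of_leftX hX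
    -- `P` splits as `A ⊞ WX` because `A` is in `C^⊥`. Covering its quotient `A` by `WA` gives `M ≅
    -- WX ⊞ WA`, and the kernel of `M ⟶ P ⟶ B` is an extension of `X'` by `A'`.
    obtain ⟨P, hP, hP'⟩ := h.pullback hcX
    obtain ⟨M, hM, hM'⟩ := hcA.pullback
      (hP.swap (rightPerp_of_leftX hA 0 WX hWX))
    obtain ⟨e⟩ := hM'.nonempty_iso_biprod (hself _ hWX 0 WA hWA)
    obtain ⟨G, hG, hG'⟩ := hP'.comp hM
    exact ⟨G, M, hG, C.prop_of_iso e.symm (hC.biprod _ _ hWX hWA), A', X', hG', hA', hX'⟩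

/-- The weak pullback `P` of `B` and a cover `W` of `X` is in `leftX C`. As `A` is in `C^⊥`, `P`
also deflates onto `A` with kernel `W`; composing with a cover of `P` covers `A`, with kernel an
extension of `W`. -/
lemma Conf.leftX_left (hC : IsAddSubcategory C) (hself : S.SelfOrthogonal C)
    (h : S.Conf A B X) (hA : S.rightPerp C A) (hB : S.leftX C B) (hX : S.leftX C X) :
    S.leftX C A := by
  obtain ⟨X', W, hc, hW, hX'⟩ := exists_conf_of_leftX hX
  obtain ⟨P, hP, hP'⟩ := h.pullback hc
  obtain ⟨P', D, hD, hCD, hP''⟩ := exists_conf_of_leftX (hP'.leftX_mid hC hself hX' hB)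
  obtain ⟨Q, hQ, hQ'⟩ := (hP.swap (hA 0 W hW)).comp hD
  exact leftX_of_conf hQ hA hCD
    (hQ'.leftX_mid hC hself hP'' (le_leftX_of_selfOrthogonal hC hself W hW))

lemma hatN_le_leftX (hC : IsAddSubcategory C) (hself : S.SelfOrthogonal C)
    (n : ℕ) : S.hatN C n ≤ S.leftX C := by
  induction n with
  | zero => exact le_leftX_of_selfOrthogonal hC hself
  | succ n ih =>
    rintro A ⟨K, W, g, f, h, hW, hK⟩
    have hK := ih K hK
    exact leftX_of_conf h.conf (h.conf.rightPerp_right (rightPerp_of_leftX hK) (hself W hW)) hW hK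

variable {ω : ObjectProperty 𝒞}

lemma leftX_le_leftX (hC : IsAddSubcategory C) (hself : S.SelfOrthogonal C)
    (hω : ω ≤ S.leftX C) (hperp : S.rightPerp ω ≤ S.rightPerp C) :
    S.leftX ω ≤ S.leftX C := by
  intro A hA
  obtain ⟨O, hO, hCO⟩ := hC.containsZero
  refine le_leftX (Z := fun B => ∃ A X, S.Conf A B X ∧ S.leftX C A ∧ S.leftX ω X) ?_ ?_ A
    ⟨O, A, Conf.of_isZero S hO A, le_leftX_of_selfOrthogonal hC hself O hCO, hA⟩
  · rintro B ⟨A, X, h, hA, hX⟩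
    exact h.rightPerp_mid (rightPerp_of_leftX hA) (hperp _ (rightPerp_of_leftX hX))
  · rintro B ⟨A, X, h, hA, hX⟩
    obtain ⟨X', W, hc, hW, hX'⟩ := exists_conf_of_leftX hX
    -- `P` extends `W` by `A`, so it is in `leftX C` and has a cover `D` in `C`. The kernel of `D ⟶
    -- P ⟶ B` extends `X'` by `P'`, so it stays in the class.
    obtain ⟨P, hP, hP'⟩ := h.pullback hc
    obtain ⟨P', D, hD, hCD, hP''⟩ :=
      exists_conf_of_leftX (hP.leftX_mid hC hself hA (hω W hW))
    obtain ⟨G, hG, hG'⟩ := hP'.comp hD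
    exact ⟨G, D, hG, hCD, P', X', hG', hP'', hX'⟩

lemma rightPerp_inf_leftX_eq (hC : IsAddSubcategory C) (hself : S.SelfOrthogonal C)
    (hω : ω ≤ S.leftX C) (hfin : S.StronglyContravariantlyFinite ω)
    (hωself : S.SelfOrthogonal ω) (hperp : S.rightPerp ω ≤ S.rightPerp C) :
    S.rightPerp ω ⊓ S.leftX C = S.leftX ω := by
  refine le_antisymm (le_leftX (fun A hA => hA.1) ?_) fun A hA =>
    ⟨rightPerp_of_leftX hA, leftX_le_leftX hC hself hω hperp A hA⟩
  rintro A ⟨hA, hA'⟩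
  obtain ⟨K, W, k, g, h, hW, hg⟩ := hfin A
  have hK := rightPerp_of_right_approximation h hg (hωself W hW) hA
  exact ⟨K, W, h.conf, hW, hK, h.conf.leftX_left hC hself (hperp K hK) (hω W hW) hA'⟩

end LeftX

end ExtStructure

end Extri

theorem mainTheorem11 {𝒞 : Type u} [Category.{v} 𝒞] [Preadditive 𝒞] [HasFiniteBiproducts 𝒞]
    (S : Extri.ExtStructure.{w} 𝒞) [S.HasEnoughProjectives] [S.HasEnoughInjectives]
    (hKS : Extri.IsKrullSchmidt 𝒞) (hWIC : S.WIC)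
    (C : ObjectProperty 𝒞) (hC : Extri.IsAddSubcategory C) :
    (∀ ω : ObjectProperty 𝒞, Extri.IsAddSubcategory ω →
      S.SelfOrthogonal C → ω ≤ S.leftX C → S.StronglyContravariantlyFinite ω →
      S.SelfOrthogonal ω → C ≤ S.check ω →
        S.rightPerp ω ≤ S.rightPerp C ∧ S.rightPerp ω ⊓ S.leftX C = S.leftX ω) ∧
    (∀ T : ObjectProperty 𝒞, Extri.IsAddSubcategory T →
      S.StronglyContravariantlyFinite T → S.IsTiltingPair C T →
        S.rightPerp T ≤ S.rightPerp C ∧ S.rightPerp T ⊓ S.leftX C = S.leftX T) := by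
  have part1 : ∀ ω : ObjectProperty 𝒞, Extri.IsAddSubcategory ω →
      S.SelfOrthogonal C → ω ≤ S.leftX C → S.StronglyContravariantlyFinite ω →
      S.SelfOrthogonal ω → C ≤ S.check ω →
        S.rightPerp ω ≤ S.rightPerp C ∧ S.rightPerp ω ⊓ S.leftX C = S.leftX ω :=
    fun ω _ hself hω hfin hωself hcheck =>
      have hperp := Extri.ExtStructure.rightPerp_le_of_le_check hcheck
      ⟨hperp, Extri.ExtStructure.rightPerp_inf_leftX_eq hC hself hω hfin hωself hperp⟩
  refine ⟨part1, fun T hT hfin hCT => part1 T hT hCT.selfOrthogonal_left (fun A hA => ?_) hfin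
    hCT.selfOrthogonal_right hCT.le_check⟩
  obtain ⟨n, hn⟩ := hCT.le_hat A hA
  exact Extri.ExtStructure.hatN_le_leftX hC hCT.selfOrthogonal_left n A hn
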